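/- Let $p \ge 1$ be a real number and let $(X,d)$ be a complete metric space (not necessarily separable). A Borel probability measure $\mu$ on $X$ is called Radon if $\mu(B) = \sup\{\mu(K) : K \subseteq B,\ K \text{ compact}\}$ for every Borel set $B \subseteq X$, and is said to have finite moment of order $p$ if $\int d(x_0,x)^p \,\mathrm{d}\mu(x) < \infty$ for some $x_0 \in X$. Let $P_p(X)$ be the set of Radon probability measures on $X$ with finite moment of order $p$, equipped with the Wasserstein distance $$W_p(\mu,\nu) = \Bigl(\inf_{\gamma} \int_{X\times X} d(x,y)^p \,\mathrm{d}\gamma(x,y)\Bigr)^{1/p},$$ where $\gamma$ runs over the couplings of $\mu$ and $\nu$, that is, the Borel probability measures on $X \times X$ whose first and second marginals are $\mu$ and $\nu$. The support of $\mu$ is the set of points all of whose open neighbourhoods have positive $\mu$-measure. Then $W_p$ is a (finite-valued) metric on $P_p(X)$, the metric space $(P_p(X), W_p)$ is complete, and the measures in $P_p(X)$ with finite support are dense in it. -/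

import Mathlib

open MeasureTheory
open scoped ENNReal

noncomputable section

/-- `γ` is a coupling between the Borel probability measures `μ` and `ν` on `X`: a measure on the
Borel σ-algebra of the product topology of `X × X` with marginals `μ` and `ν`. This σ-algebra is
written out, since for a non-separable `X` it can be strictly larger than the product σ-algebra,
which is Mathlib's default on `X × X`. That `γ` has total mass one follows from the marginals. -/
def IsBorelCoupling {X : Type*} [TopologicalSpace X] [MeasurableSpace X]
    (γ : @Measure (X × X) (borel (X × X))) (μ ν : ProbabilityMeasure X) : Prop :=
  @Measure.map (X × X) X (borel (X × X)) _ Prod.fst γ = (μ : Measure X) ∧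
  @Measure.map (X × X) X (borel (X × X)) _ Prod.snd γ = (ν : Measure X)

/-- The Wasserstein distance of order `p`, as an extended non-negative real:
`(inf_γ ∫ d(x, y) ^ p dγ(x, y)) ^ (1 / p)`, with `γ` running over the couplings of `μ` and `ν`. -/
def wassersteinEDist {X : Type*} [MetricSpace X] [MeasurableSpace X]
    (p : ℝ) (μ ν : ProbabilityMeasure X) : ℝ≥0∞ :=
  (⨅ (γ : @Measure (X × X) (borel (X × X))) (_ : IsBorelCoupling γ μ ν),
    @lintegral (X × X) (borel (X × X)) γ (fun z => edist z.1 z.2 ^ p)) ^ (1 / p)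

/-- `μ` has finite moment of order `p`. -/
def HasFiniteMoment {X : Type*} [MetricSpace X] [MeasurableSpace X]
    (p : ℝ) (μ : ProbabilityMeasure X) : Prop :=
  ∃ x₀ : X, ∫⁻ x, edist x₀ x ^ p ∂(μ : Measure X) < ∞

/-- The set `P_p(X)` of Radon probability measures on `X` with finite moment of order `p`.
`Measure.InnerRegular` says that every Borel set is inner regular with respect to compact sets.
This is a `def`, so that no topology is inherited from `ProbabilityMeasure X`. -/
def WassersteinSpace (p : ℝ) (X : Type*) [MetricSpace X] [MeasurableSpace X] : Type _ :=
  {μ : ProbabilityMeasure X // (μ : Measure X).InnerRegular ∧ HasFiniteMoment p μ}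

/-- The probability measure underlying a point of `P_p(X)`. -/
def WassersteinSpace.toProb {p : ℝ} {X : Type*} [MetricSpace X] [MeasurableSpace X]
    (μ : WassersteinSpace p X) : ProbabilityMeasure X :=
  Subtype.val μ

end

/-!
A Radon probability measure is carried by a closed separable subspace, so that a coupling of two
Radon measures on a complete space can be moved to a product of Polish subspaces, where
disintegration is available. Running the Markov chain whose transitions are the conditional
distributions of couplings of `μ n` and `μ (n + 1)` realizes all the `μ n` as laws of random
variables on one probability space, whose successive `L^p` distances are as close to
`W_p (μ n, μ (n + 1))` as desired. Every property of `W_p` that involves more than two measures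
is then a property of `L^p`: the triangle inequality is Minkowski's inequality, and a sequence of
measures with summable distances converges because its realization converges almost surely and
in `L^p`. Density holds as simple functions are dense in `L^p`, and `W_p` separates points because,
by Markov's inequality, `W_p ^ (p / (p + 1))` dominates the Lévy–Prokhorov distance.
-/

open Filter ProbabilityTheory Topology TopologicalSpace

universe u

noncomputable section

section LpEDist

variable {Ω X : Type*} [MeasurableSpace Ω] [PseudoEMetricSpace X] {p : ℝ} {P : Measure Ω}
  {f g h : Ω → X}

/-- The `L^p` distance of two random variables with values in a metric space, meaningful for
`0 < p`. -/
def lpEDist (p : ℝ) (P : Measure Ω) (f g : Ω → X) : ℝ≥0∞ :=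
  (∫⁻ ω, edist (f ω) (g ω) ^ p ∂P) ^ (1 / p)

theorem lpEDist_le_iff (hp : 0 < p) {c : ℝ≥0∞} :
    lpEDist p P f g ≤ c ↔ ∫⁻ ω, edist (f ω) (g ω) ^ p ∂P ≤ c ^ p := by
  rw [lpEDist, one_div, ENNReal.rpow_inv_le_iff hp]

theorem lpEDist_lt_iff (hp : 0 < p) {c : ℝ≥0∞} :
    lpEDist p P f g < c ↔ ∫⁻ ω, edist (f ω) (g ω) ^ p ∂P < c ^ p := by
  rw [lpEDist, one_div, ENNReal.rpow_inv_lt_iff hp]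

theorem lpEDist_lt_top_iff (hp : 0 < p) :
    lpEDist p P f g < ∞ ↔ ∫⁻ ω, edist (f ω) (g ω) ^ p ∂P < ∞ := by
  rw [lpEDist_lt_iff hp, ENNReal.top_rpow_of_pos hp]

theorem lpEDist_comm (p : ℝ) (P : Measure Ω) (f g : Ω → X) :
    lpEDist p P f g = lpEDist p P g f := by
  simp only [lpEDist, edist_comm]

theorem lpEDist_self (hp : 0 < p) (P : Measure Ω) (f : Ω → X) : lpEDist p P f f = 0 := by
  simp [lpEDist, hp]

theorem lpEDist_const [IsProbabilityMeasure P] (hp : p ≠ 0) (x y : X) :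
    lpEDist p P (fun _ => x) (fun _ => y) = edist x y := by
  simp [lpEDist, ENNReal.rpow_rpow_inv hp]

theorem lpEDist_triangle (hp : 1 ≤ p) (hf : StronglyMeasurable f) (hg : StronglyMeasurable g)
    (hh : StronglyMeasurable h) :
    lpEDist p P f h ≤ lpEDist p P f g + lpEDist p P g h := by
  refine le_trans ?_ (ENNReal.lintegral_Lp_add_le (hf.edist hg).measurable.aemeasurable
    (hg.edist hh).measurable.aemeasurable hp)
  unfold lpEDist
  gcongr
  exact edist_triangle _ _ _

theorem lpEDist_map {Ω' : Type*} [MeasurableSpace Ω'] {φ : Ω → Ω'} (hφ : Measurable φ)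
    {f g : Ω' → X} (hfg : Measurable fun ω => edist (f ω) (g ω)) :
    lpEDist p (P.map φ) f g = lpEDist p P (fun ω => f (φ ω)) (fun ω => g (φ ω)) := by
  rw [lpEDist, lintegral_map (hfg.pow_const p) hφ, lpEDist]

theorem lintegral_edist_le_lpEDist (hp : 1 ≤ p) [IsProbabilityMeasure P]
    (hfg : Measurable fun ω => edist (f ω) (g ω)) :
    ∫⁻ ω, edist (f ω) (g ω) ∂P ≤ lpEDist p P f g := by
  have := eLpNorm'_le_eLpNorm'_of_exponent_le zero_lt_one hp P hfg.aestronglyMeasurable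
  simpa [eLpNorm', lpEDist] using this

theorem lpEDist_congr_ae {f' g' : Ω → X} (hf : ∀ᵐ ω ∂P, f ω = f' ω) (hg : ∀ᵐ ω ∂P, g ω = g' ω) :
    lpEDist p P f g = lpEDist p P f' g' := by
  rw [lpEDist, lpEDist, lintegral_congr_ae]
  filter_upwards [hf, hg] with ω hfω hgω
  rw [hfω, hgω]

theorem measure_le_edist_le_of_lpEDist_le (hp : 0 < p)
    (hfg : Measurable fun ω => edist (f ω) (g ω)) {ε : ℝ≥0∞} (hε : ε ≠ 0) (hε' : ε ≠ ∞)
    (hle : lpEDist p P f g ≤ ε ^ ((p + 1) / p)) : P {ω | ε ≤ edist (f ω) (g ω)} ≤ ε := by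
  refine (ENNReal.mul_le_mul_iff_right (ENNReal.rpow_pos (pos_iff_ne_zero.2 hε) hε').ne'
    (ENNReal.rpow_ne_top_of_nonneg hp.le hε')).1 ?_
  calc ε ^ p * P {ω | ε ≤ edist (f ω) (g ω)}
      = ε ^ p * P {ω | ε ^ p ≤ edist (f ω) (g ω) ^ p} := by
        simp only [ENNReal.rpow_le_rpow_iff hp]
    _ ≤ ∫⁻ ω, edist (f ω) (g ω) ^ p ∂P := mul_meas_ge_le_lintegral (hfg.pow_const p) _
    _ ≤ (ε ^ ((p + 1) / p)) ^ p := (lpEDist_le_iff hp).1 hle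
    _ = ε ^ p * ε := by
        rw [← ENNReal.rpow_mul, div_mul_cancel₀ _ hp.ne', ENNReal.rpow_add _ _ hε hε',
          ENNReal.rpow_one]

theorem exists_simpleFunc_lpEDist_lt [MeasurableSpace X] [BorelSpace X] (hp : 0 < p)
    (hf : StronglyMeasurable f) {x : X} (hx : lpEDist p P (fun _ => x) f < ∞) {ε : ℝ≥0∞}
    (hε : 0 < ε) : ∃ g : SimpleFunc Ω X, lpEDist p P f g < ε := by
  have hsep : SeparableSpace (insert x (Set.range f) : Set X) :=
    ((Set.finite_singleton x).isSeparable.union hf.isSeparable_range).separableSpace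
  let g := SimpleFunc.approxOn f hf.measurable _ x (Set.mem_insert x (Set.range f))
  have hgf : ∀ ω, Tendsto (fun n => g n ω) atTop (𝓝 (f ω)) := fun ω =>
    SimpleFunc.tendsto_approxOn hf.measurable _ (subset_closure (Or.inr ⟨ω, rfl⟩))
  have hlim : Tendsto (fun n => ∫⁻ ω, edist (f ω) (g n ω) ^ p ∂P) atTop (𝓝 0) := by
    rw [← lintegral_zero (μ := P)]
    refine tendsto_lintegral_of_dominated_convergence (fun ω => edist x (f ω) ^ p)
      (fun n => (hf.edist (g n).stronglyMeasurable).measurable.pow_const p)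
      (fun n => ae_of_all _ fun ω => ?_) ((lpEDist_lt_top_iff hp).1 hx).ne
      (ae_of_all _ fun ω => ?_)
    · exact ENNReal.rpow_le_rpow ((edist_comm _ _).trans_le
        (SimpleFunc.edist_approxOn_le hf.measurable _ ω n)) hp.le
    · have := (ENNReal.continuous_rpow_const (y := p)).tendsto _ |>.comp
        ((tendsto_const_nhds (x := f ω)).edist (hgf ω))
      simpa [ENNReal.zero_rpow_of_pos hp, Function.comp_def] using this
  obtain ⟨n, hn⟩ :=
    (hlim.eventually_lt_const (ENNReal.rpow_pos_of_nonneg hε hp.le)).exists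
  exact ⟨g n, (lpEDist_lt_iff hp).2 hn⟩

end LpEDist

section LpComplete

variable {Ω X : Type*} [MeasurableSpace Ω] [PseudoEMetricSpace X] {p : ℝ} {P : Measure Ω}
  {f : ℕ → Ω → X} {b : ℕ → ℝ≥0∞}

theorem lpEDist_le_sum (hp : 1 ≤ p) (hf : ∀ n, StronglyMeasurable (f n))
    (hb : ∀ n, lpEDist p P (f n) (f (n + 1)) ≤ b n) (n m : ℕ) :
    lpEDist p P (f n) (f (n + m)) ≤ ∑ k ∈ Finset.range m, b (k + n) := by
  induction m with
  | zero => simp [lpEDist_self (zero_lt_one.trans_le hp)]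
  | succ m ih =>
    rw [Finset.sum_range_succ]
    refine (lpEDist_triangle hp (hf n) (hf (n + m)) (hf (n + m + 1))).trans ?_
    exact add_le_add ih ((hb (n + m)).trans_eq (by rw [add_comm]))

theorem ae_exists_tendsto_of_tsum_lpEDist_ne_top [CompleteSpace X] (hp : 1 ≤ p)
    [IsProbabilityMeasure P] (hf : ∀ n, StronglyMeasurable (f n))
    (hsum : ∑' n, lpEDist p P (f n) (f (n + 1)) ≠ ∞) :
    ∀ᵐ ω ∂P, ∃ x, Tendsto (fun n => f n ω) atTop (𝓝 x) := by
  have hm : ∀ n, Measurable fun ω => edist (f n ω) (f (n + 1) ω) := fun n =>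
    ((hf n).edist (hf (n + 1))).measurable
  have hfin : ∀ᵐ ω ∂P, ∑' n, edist (f n ω) (f (n + 1) ω) < ∞ := by
    refine ae_lt_top (Measurable.tsum hm) (ne_top_of_le_ne_top hsum ?_)
    rw [lintegral_tsum fun n => (hm n).aemeasurable]
    exact ENNReal.tsum_le_tsum fun n => lintegral_edist_le_lpEDist hp (hm n)
  filter_upwards [hfin] with ω hω
  exact cauchySeq_tendsto_of_complete
    (cauchySeq_of_edist_le_of_tsum_ne_top _ (fun _ => le_rfl) hω.ne)

theorem lpEDist_le_of_ae_tendsto (hp : 0 < p) {f₀ g : Ω → X} {c : ℝ≥0∞}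
    (hm : ∀ n, Measurable fun ω => edist (f₀ ω) (f n ω))
    (hle : ∀ n, lpEDist p P f₀ (f n) ≤ c)
    (hlim : ∀ᵐ ω ∂P, Tendsto (fun n => f n ω) atTop (𝓝 (g ω))) :
    lpEDist p P f₀ g ≤ c := by
  rw [lpEDist_le_iff hp]
  calc ∫⁻ ω, edist (f₀ ω) (g ω) ^ p ∂P
      = ∫⁻ ω, liminf (fun n => edist (f₀ ω) (f n ω) ^ p) atTop ∂P := by
        refine lintegral_congr_ae ?_
        filter_upwards [hlim] with ω hω
        exact ((ENNReal.continuous_rpow_const.tendsto _).comp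
          (tendsto_const_nhds.edist hω)).liminf_eq.symm
    _ ≤ liminf (fun n => ∫⁻ ω, edist (f₀ ω) (f n ω) ^ p ∂P) atTop :=
        lintegral_liminf_le fun n => (hm n).pow_const p
    _ ≤ c ^ p := liminf_le_of_le (by isBoundedDefault) fun _ ha =>
        let ⟨n, hn⟩ := ha.exists
        hn.trans ((lpEDist_le_iff hp).1 (hle n))

theorem exists_lpEDist_le_tsum [CompleteSpace X] (hp : 1 ≤ p) [IsProbabilityMeasure P]
    (hf : ∀ n, StronglyMeasurable (f n)) (hb : ∀ n, lpEDist p P (f n) (f (n + 1)) ≤ b n)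
    (hsum : ∑' n, b n ≠ ∞) :
    ∃ g : Ω → X, StronglyMeasurable g ∧ ∀ n, lpEDist p P (f n) g ≤ ∑' k, b (k + n) := by
  obtain ⟨g, hg, hfg⟩ := exists_stronglyMeasurable_limit_of_tendsto_ae
    (fun n => (hf n).aestronglyMeasurable)
    (ae_exists_tendsto_of_tsum_lpEDist_ne_top hp hf
      (ne_top_of_le_ne_top hsum (ENNReal.tsum_le_tsum hb)))
  refine ⟨g, hg, fun n => lpEDist_le_of_ae_tendsto (f := fun m => f (n + m))
    (zero_lt_one.trans_le hp) (fun m => ((hf n).edist (hf (n + m))).measurable)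
    (fun m => (lpEDist_le_sum hp hf hb n m).trans (ENNReal.sum_le_tsum _)) ?_⟩
  filter_upwards [hfg] with ω hω
  simpa only [add_comm n] using (tendsto_add_atTop_iff_nat n).2 hω

end LpComplete

section Gluing

theorem map_prodMap_compProd_comap {α β γ : Type*} [MeasurableSpace α] [MeasurableSpace β]
    [MeasurableSpace γ] {μ : Measure α} [SFinite μ] {κ : Kernel β γ} [IsSFiniteKernel κ]
    {φ : α → β} (hφ : Measurable φ) :
    (μ ⊗ₘ κ.comap φ hφ).map (Prod.map φ id) = μ.map φ ⊗ₘ κ := by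
  ext s hs
  rw [Measure.map_apply (by fun_prop) hs, Measure.compProd_apply (hs.preimage (by fun_prop)),
    Measure.compProd_apply hs, lintegral_map (Kernel.measurable_kernel_prodMk_left hs) hφ]
  rfl

variable {E : ℕ → Type*} [∀ n, MeasurableSpace (E n)]

/-- The law of the Markov chain with initial law `μ₀` and with transition kernel `κ n` from time
`n` to time `n + 1`. -/
def markovChainMeasure (μ₀ : Measure (E 0)) (κ : ∀ n, Kernel (E n) (E (n + 1)))
    [∀ n, IsMarkovKernel (κ n)] : Measure (∀ n, E n) :=
  Kernel.trajMeasure μ₀ fun n =>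
    (κ n).comap (fun ω => ω ⟨n, Finset.mem_Iic.2 le_rfl⟩) (measurable_pi_apply _)

variable {μ₀ : Measure (E 0)} {κ : ∀ n, Kernel (E n) (E (n + 1))} [∀ n, IsMarkovKernel (κ n)]

theorem map_eval_zero_markovChainMeasure :
    (markovChainMeasure μ₀ κ).map (fun ω => ω 0) = μ₀ := by
  let past : E 0 → ∀ i : Finset.Iic 0, E i :=
    (MeasurableEquiv.piUnique fun i : Finset.Iic 0 => E i).symm
  have hpast : Measurable past := MeasurableEquiv.measurable _
  have hmap : (markovChainMeasure μ₀ κ).map (Preorder.frestrictLe 0) = μ₀.map past := by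
    rw [markovChainMeasure, Kernel.trajMeasure, Measure.map_comp _ _ (by fun_prop),
      Kernel.traj_map_frestrictLe, Kernel.partialTraj_self, Measure.id_comp]
    rfl
  calc (markovChainMeasure μ₀ κ).map (fun ω => ω 0)
      = ((markovChainMeasure μ₀ κ).map (Preorder.frestrictLe 0)).map
          (fun ω : ∀ i : Finset.Iic 0, E i => ω ⟨0, Finset.mem_Iic.2 le_rfl⟩) := by
        rw [Measure.map_map (by fun_prop) (by fun_prop)]
        rfl
    _ = μ₀.map id := by
        rw [hmap, Measure.map_map (by fun_prop) hpast]
        rfl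
    _ = μ₀ := Measure.map_id

variable [IsProbabilityMeasure μ₀]

instance : IsProbabilityMeasure (markovChainMeasure μ₀ κ) := by
  unfold markovChainMeasure
  infer_instance

theorem map_pair_markovChainMeasure (n : ℕ) :
    (markovChainMeasure μ₀ κ).map (fun ω => (ω n, ω (n + 1))) =
      (markovChainMeasure μ₀ κ).map (fun ω => ω n) ⊗ₘ κ n := by
  set P := markovChainMeasure μ₀ κ with hP
  let last : (∀ i : Finset.Iic n, E i) → E n := fun ω => ω ⟨n, Finset.mem_Iic.2 le_rfl⟩
  have hlast : Measurable last := measurable_pi_apply _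
  calc P.map (fun ω => (ω n, ω (n + 1)))
      = (P.map fun ω => (Preorder.frestrictLe n ω, ω (n + 1))).map (Prod.map last id) := by
        rw [Measure.map_map (by fun_prop) (by fun_prop)]
        rfl
    _ = (P.map (Preorder.frestrictLe n) ⊗ₘ (κ n).comap last hlast).map (Prod.map last id) := by
        rw [hP, markovChainMeasure,
          ← Kernel.map_frestrictLe_trajMeasure_compProd_eq_map_trajMeasure]
    _ = (P.map (Preorder.frestrictLe n)).map last ⊗ₘ κ n := map_prodMap_compProd_comap hlast
    _ = P.map (fun ω => ω n) ⊗ₘ κ n := by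
        rw [Measure.map_map hlast (by fun_prop)]
        rfl

theorem exists_measure_forall_map_pair_eq [∀ n, StandardBorelSpace (E n)] [∀ n, Nonempty (E n)]
    (γ : ∀ n, Measure (E n × E (n + 1))) [∀ n, IsProbabilityMeasure (γ n)]
    (h : ∀ n, (γ n).snd = (γ (n + 1)).fst) :
    ∃ P : Measure (∀ n, E n), IsProbabilityMeasure P ∧
      ∀ n, P.map (fun ω => (ω n, ω (n + 1))) = γ n := by
  let P := markovChainMeasure (γ 0).fst fun n => (γ n).condKernel
  have map_pair_of_map_eval : ∀ n, P.map (fun ω => ω n) = (γ n).fst →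
      P.map (fun ω => (ω n, ω (n + 1))) = γ n := fun n hn => by
    rw [map_pair_markovChainMeasure, hn, (γ n).disintegrate]
  refine ⟨P, inferInstance, fun n => map_pair_of_map_eval n ?_⟩
  induction n with
  | zero => exact map_eval_zero_markovChainMeasure
  | succ n ih =>
    rw [← h n, ← map_pair_of_map_eval n ih, Measure.snd_map_prodMk (by fun_prop)]

end Gluing

section Radon

variable {X : Type*} [TopologicalSpace X] [MeasurableSpace X] [BorelSpace X]

theorem exists_isClosed_isSeparable_measure_compl_eq_zero [PseudoMetrizableSpace X]
    (μ : Measure X) [IsFiniteMeasure μ] [μ.InnerRegular] :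
    ∃ S : Set X, IsClosed S ∧ IsSeparable S ∧ μ Sᶜ = 0 := by
  have hK : ∀ n : ℕ, ∃ K : Set X, IsCompact K ∧ μ Kᶜ < (n : ℝ≥0∞)⁻¹ := fun n => by
    obtain ⟨K, -, hK, -, hlt⟩ := MeasurableSet.univ.exists_isCompact_isClosed_sdiff_lt
      (measure_ne_top μ _) (ENNReal.inv_ne_zero.2 (ENNReal.natCast_ne_top n))
    exact ⟨K, hK, by rwa [Set.compl_eq_univ_sdiff]⟩
  choose K hKc hKμ using hK
  refine ⟨closure (⋃ n, K n), isClosed_closure,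
    (IsSeparable.iUnion fun n => (hKc n).isSeparable).closure, ?_⟩
  by_contra hpos
  obtain ⟨n, hn⟩ := ENNReal.exists_inv_nat_lt hpos
  refine (hn.trans_le (measure_mono ?_)).not_gt (hKμ n)
  exact Set.compl_subset_compl.2 ((Set.subset_iUnion K n).trans subset_closure)

theorem exists_polishSpace_measurable_ae_eq [IsCompletelyMetrizableSpace X] (μ : Measure X)
    [IsFiniteMeasure μ] [NeZero μ] [μ.InnerRegular] :
    ∃ (S : Set X) (_ : PolishSpace S) (r : X → S),
      Measurable r ∧ ∀ᵐ x ∂μ, (r x : X) = x := by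
  obtain ⟨S, hS, hsep, hμS⟩ := exists_isClosed_isSeparable_measure_compl_eq_zero μ
  have hne : S.Nonempty := by
    rw [Set.nonempty_iff_ne_empty]
    rintro rfl
    simp [NeZero.ne μ] at hμS
  have := hsep.secondCountableTopology
  have := hS.isCompletelyMetrizableSpace
  obtain ⟨r, hr, hrS⟩ := hS.measurableSet.exists_measurable_proj hne
  refine ⟨S, inferInstance, r, hr, ?_⟩
  filter_upwards [mem_ae_iff.2 hμS] with x hx
  exact congrArg Subtype.val (hrS ⟨x, hx⟩)

theorem exists_stronglyMeasurable_measurePreserving [PseudoMetrizableSpace X] (μ : Measure X)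
    [IsFiniteMeasure μ] [μ.InnerRegular] :
    ∃ r : X → X, StronglyMeasurable r ∧ MeasurePreserving r μ μ := by
  obtain ⟨S, -, hsep, hμS⟩ := exists_isClosed_isSeparable_measure_compl_eq_zero μ
  obtain ⟨r, hr, hid⟩ : AEStronglyMeasurable id μ :=
    aestronglyMeasurable_iff_aemeasurable_separable.2 ⟨aemeasurable_id, S, hsep, mem_ae_iff.2 hμS⟩
  exact ⟨r, hr, hr.measurable, (Measure.map_congr hid).symm.trans Measure.map_id⟩

theorem innerRegular_map_of_stronglyMeasurable [IsCompletelyMetrizableSpace X] {Ω : Type*}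
    [MeasurableSpace Ω] {P : Measure Ω} [IsFiniteMeasure P] {f : Ω → X}
    (hf : StronglyMeasurable f) : (P.map f).InnerRegular := by
  let S : Set X := closure (Set.range f)
  have := hf.isSeparable_range.closure.secondCountableTopology
  have := (isClosed_closure : IsClosed S).isCompletelyMetrizableSpace
  let f' : Ω → S := fun ω => ⟨f ω, subset_closure ⟨ω, rfl⟩⟩
  have hf' : Measurable f' := hf.measurable.subtype_mk
  have hmap : P.map f = (P.map f').map Subtype.val := by
    rw [Measure.map_map measurable_subtype_coe hf']
    rfl
  rw [hmap]
  exact Measure.InnerRegular.map_of_continuous continuous_subtype_val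

end Radon

section JointlyBorel

variable {Ω X : Type*} [MeasurableSpace Ω] [TopologicalSpace X] {f g : Ω → X}

/-- `(f, g)` is a random variable for the Borel σ-algebra of `X × X`, the one on which couplings
live. If `X` is not separable, this may say more than that `f` and `g` are measurable. -/
def JointlyBorel (f g : Ω → X) : Prop :=
  @Measurable Ω (X × X) _ (borel (X × X)) fun ω => (f ω, g ω)

namespace JointlyBorel

theorem continuous_comp {Y : Type*} [TopologicalSpace Y] [MeasurableSpace Y] [BorelSpace Y]
    {φ : X × X → Y} (hφ : Continuous φ) (h : JointlyBorel f g) :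
    Measurable fun ω => φ (f ω, g ω) := by
  let := borel (X × X)
  have : BorelSpace (X × X) := ⟨rfl⟩
  exact hφ.measurable.comp h

protected theorem symm (h : JointlyBorel f g) : JointlyBorel g f := by
  let := borel (X × X)
  have : BorelSpace (X × X) := ⟨rfl⟩
  exact h.continuous_comp continuous_swap

protected theorem edist {X : Type*} [PseudoEMetricSpace X] {f g : Ω → X} (h : JointlyBorel f g) :
    Measurable fun ω => edist (f ω) (g ω) :=
  h.continuous_comp continuous_edist

section

variable [MeasurableSpace X] [BorelSpace X]

theorem measurable_left (h : JointlyBorel f g) : Measurable f :=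
  h.continuous_comp continuous_fst

theorem measurable_right (h : JointlyBorel f g) : Measurable g :=
  h.continuous_comp continuous_snd

protected theorem self (hf : Measurable f) : JointlyBorel f f := by
  let := borel (X × X)
  have : BorelSpace (X × X) := ⟨rfl⟩
  have hdiag : Continuous fun x : X => (x, x) := by fun_prop
  exact hdiag.measurable.comp hf

end

theorem of_stronglyMeasurable [PseudoMetrizableSpace X] (hf : StronglyMeasurable f)
    (hg : StronglyMeasurable g) : JointlyBorel f g := by
  let := borel (X × X)
  have : BorelSpace (X × X) := ⟨rfl⟩
  exact (hf.prodMk hg).measurable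

end JointlyBorel

end JointlyBorel

section Coupling

variable {X : Type u} [MetricSpace X] [MeasurableSpace X] {p : ℝ} {μ ν : ProbabilityMeasure X}

theorem exists_jointlyBorel_lpEDist_lt (hp : 0 < p) {c : ℝ≥0∞} (h : wassersteinEDist p μ ν < c) :
    ∃ (Ω : Type u) (_ : MeasurableSpace Ω) (P : Measure Ω) (f g : Ω → X), JointlyBorel f g ∧
      P.map f = μ ∧ P.map g = ν ∧ lpEDist p P f g < c := by
  rw [wassersteinEDist, one_div, ENNReal.rpow_inv_lt_iff hp] at h
  simp only [iInf_lt_iff] at h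
  obtain ⟨γ, ⟨hμ, hν⟩, hγ⟩ := h
  let := borel (X × X)
  exact ⟨X × X, borel (X × X), γ, Prod.fst, Prod.snd, measurable_id, hμ, hν,
    (lpEDist_lt_iff hp).2 hγ⟩

variable [BorelSpace X]

theorem wassersteinEDist_le_lpEDist {Ω : Type*} [MeasurableSpace Ω] {P : Measure Ω} {f g : Ω → X}
    (hp : 0 ≤ p) (hfg : JointlyBorel f g) (hf : P.map f = μ) (hg : P.map g = ν) :
    wassersteinEDist p μ ν ≤ lpEDist p P f g := by
  let := borel (X × X)
  have : BorelSpace (X × X) := ⟨rfl⟩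
  have hpair : Measurable fun ω => (f ω, g ω) := hfg
  have hcost : Measurable fun z : X × X => edist z.1 z.2 ^ p :=
    continuous_edist.measurable.pow_const p
  refine ENNReal.rpow_le_rpow
    (iInf₂_le_of_le (P.map fun ω => (f ω, g ω)) ⟨?_, ?_⟩ ?_) (one_div_nonneg.2 hp)
  · exact (Measure.map_map continuous_fst.measurable hpair).trans hf
  · exact (Measure.map_map continuous_snd.measurable hpair).trans hg
  · exact (lintegral_map hcost hpair).le

theorem wassersteinEDist_self (hp : 0 < p) (μ : ProbabilityMeasure X) :
    wassersteinEDist p μ μ = 0 :=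
  le_antisymm ((wassersteinEDist_le_lpEDist hp.le (JointlyBorel.self measurable_id)
    Measure.map_id Measure.map_id).trans_eq (lpEDist_self hp _ _)) zero_le

theorem wassersteinEDist_comm_le (hp : 0 < p) (μ ν : ProbabilityMeasure X) :
    wassersteinEDist p ν μ ≤ wassersteinEDist p μ ν := by
  refine le_of_forall_gt fun c hc => ?_
  obtain ⟨Ω, _, P, f, g, hfg, hf, hg, hlt⟩ := exists_jointlyBorel_lpEDist_lt hp hc
  calc wassersteinEDist p ν μ ≤ lpEDist p P g f := wassersteinEDist_le_lpEDist hp.le hfg.symm hg hf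
    _ = lpEDist p P f g := lpEDist_comm p P g f
    _ < c := hlt

theorem wassersteinEDist_comm (hp : 0 < p) (μ ν : ProbabilityMeasure X) :
    wassersteinEDist p μ ν = wassersteinEDist p ν μ :=
  (wassersteinEDist_comm_le hp ν μ).antisymm (wassersteinEDist_comm_le hp μ ν)

end Coupling

section LevyProkhorov

variable {X : Type u} [MetricSpace X] [MeasurableSpace X] [BorelSpace X] {p : ℝ}

theorem map_apply_le_map_thickening_add {Ω : Type*} [MeasurableSpace Ω] {P : Measure Ω}
    {f g : Ω → X} (hf : Measurable f) (hg : Measurable g) {B : Set X} (hB : MeasurableSet B)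
    {ε : ℝ≥0∞} (hε : ε ≠ ∞) :
    P.map f B ≤ P.map g (Metric.thickening ε.toReal B) + P {ω | ε ≤ edist (f ω) (g ω)} := by
  rw [Measure.map_apply hf hB, Measure.map_apply hg Metric.isOpen_thickening.measurableSet]
  refine (measure_mono fun ω hω => ?_).trans (measure_union_le _ _)
  rcases le_or_gt ε (edist (f ω) (g ω)) with hfar | hnear
  · exact Or.inr hfar
  · refine Or.inl (Metric.mem_thickening_iff.2 ⟨f ω, hω, ?_⟩)
    rwa [edist_comm, edist_dist, ENNReal.ofReal_lt_iff_lt_toReal dist_nonneg hε] at hnear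

theorem levyProkhorovEDist_le_wassersteinEDist_rpow (hp : 0 < p) (μ ν : ProbabilityMeasure X) :
    levyProkhorovEDist (μ : Measure X) ν ≤ wassersteinEDist p μ ν ^ (p / (p + 1)) := by
  refine levyProkhorovEDist_le_of_forall_le _ _ _ fun ε B hε hε_top hB => ?_
  have hW : wassersteinEDist p μ ν < ε ^ ((p + 1) / p) := by
    rwa [← inv_div p, ENNReal.lt_rpow_inv_iff (by positivity)]
  obtain ⟨Ω, _, P, f, g, hfg, hf, hg, hlt⟩ := exists_jointlyBorel_lpEDist_lt hp hW
  rw [← hf, ← hg]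
  refine (map_apply_le_map_thickening_add hfg.measurable_left hfg.measurable_right hB
    hε_top.ne).trans (add_le_add le_rfl ?_)
  exact measure_le_edist_le_of_lpEDist_le hp hfg.edist (bot_lt_of_lt hε).ne' hε_top.ne hlt.le

theorem eq_of_wassersteinEDist_eq_zero (hp : 0 < p) {μ ν : ProbabilityMeasure X}
    (h : wassersteinEDist p μ ν = 0) : μ = ν := by
  suffices hzero : edist (LevyProkhorov.ofMeasure μ) (LevyProkhorov.ofMeasure ν) ≤ 0 from
    congrArg LevyProkhorov.toMeasure (edist_le_zero.1 hzero)
  calc edist (LevyProkhorov.ofMeasure μ) (LevyProkhorov.ofMeasure ν)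
      = levyProkhorovEDist (μ : Measure X) ν := LevyProkhorov.edist_probabilityMeasure_def _ _
    _ ≤ wassersteinEDist p μ ν ^ (p / (p + 1)) :=
        levyProkhorovEDist_le_wassersteinEDist_rpow hp μ ν
    _ = 0 := by rw [h, ENNReal.zero_rpow_of_pos (by positivity)]

end LevyProkhorov

section Realization

theorem map_coe_eq_of_map_eq {Ω X : Type*} [MeasurableSpace Ω] [MeasurableSpace X] {P : Measure Ω}
    {μ : Measure X} {S : Set X} {r : X → S} (hr : Measurable r) (hμ : ∀ᵐ x ∂μ, (r x : X) = x)
    {f : Ω → S} (hf : Measurable f) (h : P.map f = μ.map r) : P.map (fun ω => (f ω : X)) = μ :=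
  calc P.map (fun ω => (f ω : X))
      = (P.map f).map (↑) := (Measure.map_map measurable_subtype_coe hf).symm
    _ = μ.map (fun x => (r x : X)) := by rw [h, Measure.map_map measurable_subtype_coe hr]; rfl
    _ = μ.map id := Measure.map_congr hμ
    _ = μ := Measure.map_id

variable {X : Type u} [MetricSpace X] [MeasurableSpace X] [BorelSpace X] {p : ℝ}

theorem measurable_edist_coe_prod {S T : Set X} [SecondCountableTopology S]
    [SecondCountableTopology T] : Measurable fun z : S × T => edist (z.1 : X) (z.2 : X) :=
  ((continuous_subtype_val.stronglyMeasurable.comp_measurable measurable_fst).edist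
    (continuous_subtype_val.stronglyMeasurable.comp_measurable measurable_snd)).measurable

theorem exists_measure_prod_lpEDist_lt (hp : 0 < p) {μ ν : ProbabilityMeasure X} {S T : Set X}
    [SecondCountableTopology S] [SecondCountableTopology T] {r : X → S} {s : X → T}
    (hr : Measurable r) (hs : Measurable s) (hμ : ∀ᵐ x ∂(μ : Measure X), (r x : X) = x)
    (hν : ∀ᵐ x ∂(ν : Measure X), (s x : X) = x) {c : ℝ≥0∞} (h : wassersteinEDist p μ ν < c) :
    ∃ γ : Measure (S × T), IsProbabilityMeasure γ ∧ γ.fst = (μ : Measure X).map r ∧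
      γ.snd = (ν : Measure X).map s ∧ lpEDist p γ (fun z => (z.1 : X)) (fun z => z.2) < c := by
  obtain ⟨Ω, _, P, f, g, hfg, hf, hg, hlt⟩ := exists_jointlyBorel_lpEDist_lt hp h
  have hfm := hfg.measurable_left
  have hgm := hfg.measurable_right
  have : IsProbabilityMeasure P := by
    have : IsProbabilityMeasure (P.map f) := hf ▸ inferInstance
    exact Measure.isProbabilityMeasure_of_map f
  have hpair : Measurable fun ω => (r (f ω), s (g ω)) := (hr.comp hfm).prodMk (hs.comp hgm)
  refine ⟨P.map fun ω => (r (f ω), s (g ω)), Measure.isProbabilityMeasure_map hpair.aemeasurable,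
    ?_, ?_, ?_⟩
  · rw [Measure.fst_map_prodMk (by fun_prop), ← hf, Measure.map_map hr hfm]
    rfl
  · rw [Measure.snd_map_prodMk (by fun_prop), ← hg, Measure.map_map hs hgm]
    rfl
  · have hrf : ∀ᵐ ω ∂P, (r (f ω) : X) = f ω := ae_of_ae_map hfm.aemeasurable (hf ▸ hμ)
    have hsg : ∀ᵐ ω ∂P, (s (g ω) : X) = g ω := ae_of_ae_map hgm.aemeasurable (hg ▸ hν)
    rw [lpEDist_map hpair measurable_edist_coe_prod]
    exact (lpEDist_congr_ae hrf hsg).trans_lt hlt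

theorem exists_stronglyMeasurable_lpEDist_lt [CompleteSpace X] (hp : 0 < p)
    (μ : ℕ → ProbabilityMeasure X) [∀ n, (μ n : Measure X).InnerRegular] {b : ℕ → ℝ≥0∞}
    (hb : ∀ n, wassersteinEDist p (μ n) (μ (n + 1)) < b n) :
    ∃ (Ω : Type u) (_ : MeasurableSpace Ω) (P : Measure Ω) (f : ℕ → Ω → X),
      IsProbabilityMeasure P ∧ (∀ n, StronglyMeasurable (f n)) ∧ (∀ n, P.map (f n) = μ n) ∧
      ∀ n, lpEDist p P (f n) (f (n + 1)) < b n := by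
  choose S hS r hr hμ using fun n => exists_polishSpace_measurable_ae_eq (μ n : Measure X)
  choose γ hγ hfst hsnd hlt using fun n =>
    exists_measure_prod_lpEDist_lt hp (hr n) (hr (n + 1)) (hμ n) (hμ (n + 1)) (hb n)
  have hne : ∀ n, Nonempty (S n) := fun n =>
    ⟨r n ((μ n : Measure X).nonempty_of_neZero.some)⟩
  obtain ⟨P, hP, hPγ⟩ := exists_measure_forall_map_pair_eq γ fun n =>
    (hsnd n).trans (hfst (n + 1)).symm
  have hpair : ∀ n, Measurable fun ω : ∀ n, S n => (ω n, ω (n + 1)) := fun n => by fun_prop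
  have hsm : ∀ n, StronglyMeasurable fun ω : ∀ n, S n => (ω n : X) := fun n =>
    continuous_subtype_val.stronglyMeasurable.comp_measurable (measurable_pi_apply n)
  refine ⟨∀ n, S n, inferInstance, P, fun n ω => ω n, hP, hsm, fun n => ?_, fun n => ?_⟩
  · refine map_coe_eq_of_map_eq (hr n) (hμ n) (measurable_pi_apply n) ?_
    rw [← hfst n, ← hPγ n, Measure.fst_map_prodMk (measurable_pi_apply _)]
  · rw [← lpEDist_map (hpair n) (f := fun z => (z.1 : X)) (g := fun z => (z.2 : X))
      measurable_edist_coe_prod, hPγ n]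
    exact hlt n

theorem wassersteinEDist_le_add_of_lt [CompleteSpace X] (hp : 1 ≤ p) {μ ν ρ : ProbabilityMeasure X}
    [(μ : Measure X).InnerRegular] [(ν : Measure X).InnerRegular]
    [(ρ : Measure X).InnerRegular] {a b : ℝ≥0∞} (hμν : wassersteinEDist p μ ν < a)
    (hνρ : wassersteinEDist p ν ρ < b) : wassersteinEDist p μ ρ ≤ a + b := by
  have hp0 : 0 < p := zero_lt_one.trans_le hp
  let law : ℕ → ProbabilityMeasure X
    | 0 => μ
    | 1 => ν
    | _ + 2 => ρ
  let bound : ℕ → ℝ≥0∞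
    | 0 => a
    | 1 => b
    | _ + 2 => 1
  have hlaw : ∀ n, (law n : Measure X).InnerRegular
    | 0 => ‹(μ : Measure X).InnerRegular›
    | 1 => ‹(ν : Measure X).InnerRegular›
    | _ + 2 => ‹(ρ : Measure X).InnerRegular›
  have hbound : ∀ n, wassersteinEDist p (law n) (law (n + 1)) < bound n
    | 0 => hμν
    | 1 => hνρ
    | _ + 2 => (wassersteinEDist_self hp0 ρ).trans_lt one_pos
  obtain ⟨Ω, _, P, f, _, hf, hmap, hlt⟩ := exists_stronglyMeasurable_lpEDist_lt hp0 law hbound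
  calc wassersteinEDist p μ ρ
      ≤ lpEDist p P (f 0) (f 2) :=
        wassersteinEDist_le_lpEDist hp0.le (.of_stronglyMeasurable (hf 0) (hf 2)) (hmap 0) (hmap 2)
    _ ≤ lpEDist p P (f 0) (f 1) + lpEDist p P (f 1) (f 2) :=
        lpEDist_triangle hp (hf 0) (hf 1) (hf 2)
    _ ≤ a + b := add_le_add (hlt 0).le (hlt 1).le

theorem wassersteinEDist_triangle [CompleteSpace X] (hp : 1 ≤ p) (μ ν ρ : ProbabilityMeasure X)
    [(μ : Measure X).InnerRegular] [(ν : Measure X).InnerRegular]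
    [(ρ : Measure X).InnerRegular] :
    wassersteinEDist p μ ρ ≤ wassersteinEDist p μ ν + wassersteinEDist p ν ρ := by
  refine ENNReal.le_of_forall_pos_le_add fun ε hε hfin => ?_
  obtain ⟨hμν, hνρ⟩ := ENNReal.add_lt_top.1 hfin
  have hε2 : (ε : ℝ≥0∞) / 2 ≠ 0 := by simpa using hε.ne'
  calc wassersteinEDist p μ ρ
      ≤ wassersteinEDist p μ ν + ε / 2 + (wassersteinEDist p ν ρ + ε / 2) :=
        wassersteinEDist_le_add_of_lt hp (ENNReal.lt_add_right hμν.ne hε2)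
          (ENNReal.lt_add_right hνρ.ne hε2)
    _ = wassersteinEDist p μ ν + wassersteinEDist p ν ρ + ε := by
        rw [add_add_add_comm, ENNReal.add_halves]

end Realization

section Moment

variable {X : Type*} [MetricSpace X] [MeasurableSpace X] [BorelSpace X] {p : ℝ}

theorem hasFiniteMoment_iff_exists_lpEDist_lt_top {Ω : Type*} [MeasurableSpace Ω] {P : Measure Ω}
    {f : Ω → X} {μ : ProbabilityMeasure X} (hp : 0 < p) (hf : Measurable f) (hμ : P.map f = μ) :
    HasFiniteMoment p μ ↔ ∃ x, lpEDist p P (fun _ => x) f < ∞ := by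
  refine exists_congr fun x => ?_
  rw [lpEDist_lt_top_iff hp, ← hμ, lintegral_map (measurable_edist_right.pow_const p) hf]

theorem wassersteinEDist_lt_top (hp : 1 ≤ p) {μ ν : ProbabilityMeasure X}
    [(μ : Measure X).InnerRegular] [(ν : Measure X).InnerRegular] (hμ : HasFiniteMoment p μ)
    (hν : HasFiniteMoment p ν) : wassersteinEDist p μ ν < ∞ := by
  have hp0 : 0 < p := zero_lt_one.trans_le hp
  obtain ⟨r, hr, hμr⟩ := exists_stronglyMeasurable_measurePreserving (μ : Measure X)
  obtain ⟨s, hs, hνs⟩ := exists_stronglyMeasurable_measurePreserving (ν : Measure X)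
  let P : Measure (X × X) := (μ : Measure X).prod ν
  let f : X × X → X := fun z => r z.1
  let g : X × X → X := fun z => s z.2
  have hf : StronglyMeasurable f := hr.comp_measurable measurable_fst
  have hg : StronglyMeasurable g := hs.comp_measurable measurable_snd
  have hfμ : P.map f = μ := (hμr.comp measurePreserving_fst).map_eq
  have hgν : P.map g = ν := (hνs.comp measurePreserving_snd).map_eq
  obtain ⟨x, hx⟩ := (hasFiniteMoment_iff_exists_lpEDist_lt_top hp0 hf.measurable hfμ).1 hμ
  obtain ⟨y, hy⟩ := (hasFiniteMoment_iff_exists_lpEDist_lt_top hp0 hg.measurable hgν).1 hν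
  calc wassersteinEDist p μ ν
      ≤ lpEDist p P f g :=
        wassersteinEDist_le_lpEDist hp0.le (.of_stronglyMeasurable hf hg) hfμ hgν
    _ ≤ lpEDist p P f (fun _ => x) + lpEDist p P (fun _ => x) g :=
        lpEDist_triangle hp hf stronglyMeasurable_const hg
    _ ≤ lpEDist p P f (fun _ => x) +
          (lpEDist p P (fun _ => x) (fun _ => y) + lpEDist p P (fun _ => y) g) :=
        add_le_add_right
          (lpEDist_triangle hp stronglyMeasurable_const stronglyMeasurable_const hg) _
    _ < ∞ := by
        rw [lpEDist_comm p P f, lpEDist_const hp0.ne']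
        exact ENNReal.add_lt_top.2 ⟨hx, ENNReal.add_lt_top.2 ⟨edist_lt_top x y, hy⟩⟩

end Moment

namespace WassersteinSpace

variable {X : Type u} [MetricSpace X] [MeasurableSpace X] {p : ℝ}

theorem toProb_injective :
    Function.Injective (toProb : WassersteinSpace p X → ProbabilityMeasure X) :=
  Subtype.val_injective

instance (μ : WassersteinSpace p X) : (μ.toProb : Measure X).InnerRegular :=
  μ.2.1

theorem hasFiniteMoment (μ : WassersteinSpace p X) : HasFiniteMoment p μ.toProb :=
  μ.2.2

variable [CompleteSpace X] [BorelSpace X]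

theorem exists_map_eq_toProb (hp : 1 ≤ p) {Ω : Type*} [MeasurableSpace Ω] {P : Measure Ω}
    [IsProbabilityMeasure P] {f g : Ω → X} (hf : StronglyMeasurable f) (hg : StronglyMeasurable g)
    {μ : WassersteinSpace p X} (hμ : P.map f = μ.toProb) (hfg : lpEDist p P f g < ∞) :
    ∃ ν : WassersteinSpace p X, P.map g = ν.toProb := by
  have hp0 : 0 < p := zero_lt_one.trans_le hp
  let ν : ProbabilityMeasure X :=
    ⟨P.map g, Measure.isProbabilityMeasure_map hg.measurable.aemeasurable⟩
  obtain ⟨x, hx⟩ :=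
    (hasFiniteMoment_iff_exists_lpEDist_lt_top hp0 hf.measurable hμ).1 μ.hasFiniteMoment
  have hν : HasFiniteMoment p ν :=
    (hasFiniteMoment_iff_exists_lpEDist_lt_top hp0 hg.measurable rfl).2
      ⟨x, (lpEDist_triangle hp stronglyMeasurable_const hf hg).trans_lt
        (ENNReal.add_lt_top.2 ⟨hx, hfg⟩)⟩
  exact ⟨⟨ν, innerRegular_map_of_stronglyMeasurable hg, hν⟩, rfl⟩

theorem exists_wassersteinEDist_le_tsum (hp : 1 ≤ p) (μ : ℕ → WassersteinSpace p X)
    {b : ℕ → ℝ≥0∞} (hb : ∀ n, wassersteinEDist p (μ n).toProb (μ (n + 1)).toProb < b n)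
    (hsum : ∑' n, b n ≠ ∞) :
    ∃ ν : WassersteinSpace p X,
      ∀ n, wassersteinEDist p (μ n).toProb ν.toProb ≤ ∑' k, b (k + n) := by
  have hp0 : 0 < p := zero_lt_one.trans_le hp
  obtain ⟨Ω, _, P, f, _, hf, hμ, hlt⟩ :=
    exists_stronglyMeasurable_lpEDist_lt hp0 (fun n => (μ n).toProb) hb
  obtain ⟨g, hg, hle⟩ := exists_lpEDist_le_tsum hp hf (fun n => (hlt n).le) hsum
  obtain ⟨ν, hν⟩ := exists_map_eq_toProb hp (hf 0) hg (hμ 0) ((hle 0).trans_lt hsum.lt_top)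
  exact ⟨ν, fun n => (wassersteinEDist_le_lpEDist hp0.le (.of_stronglyMeasurable (hf n) hg)
    (hμ n) hν).trans (hle n)⟩

theorem exists_finite_support_wassersteinEDist_lt (hp : 1 ≤ p) (μ : WassersteinSpace p X)
    {ε : ℝ≥0∞} (hε : 0 < ε) :
    ∃ ν : WassersteinSpace p X, (ν.toProb : Measure X).support.Finite ∧
      wassersteinEDist p μ.toProb ν.toProb < ε := by
  have hp0 : 0 < p := zero_lt_one.trans_le hp
  obtain ⟨r, hr, hμ⟩ := exists_stronglyMeasurable_measurePreserving (μ.toProb : Measure X)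
  obtain ⟨x, hx⟩ :=
    (hasFiniteMoment_iff_exists_lpEDist_lt_top hp0 hr.measurable hμ.map_eq).1 μ.hasFiniteMoment
  obtain ⟨g, hg⟩ := exists_simpleFunc_lpEDist_lt hp0 hr hx hε
  obtain ⟨ν, hν⟩ := exists_map_eq_toProb hp hr g.stronglyMeasurable hμ.map_eq (hg.trans_le le_top)
  refine ⟨ν, g.finite_range.subset
    (Measure.support_subset_of_isClosed g.finite_range.isClosed ?_), ?_⟩
  · rw [← hν, mem_ae_map_iff g.measurable.aemeasurable g.finite_range.measurableSet]
    exact univ_mem' Set.mem_range_self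
  · exact (wassersteinEDist_le_lpEDist hp0.le (.of_stronglyMeasurable hr g.stronglyMeasurable)
      hμ.map_eq hν).trans_lt hg

/-- The Wasserstein metric on `P_p(X)`. It is not an instance, since it depends on a proof of
`1 ≤ p`. -/
@[reducible]
def metricSpace (hp : 1 ≤ p) : MetricSpace (WassersteinSpace p X) :=
  let _ : EMetricSpace (WassersteinSpace p X) :=
    { edist := fun μ ν => wassersteinEDist p μ.toProb ν.toProb
      edist_self := fun μ => wassersteinEDist_self (zero_lt_one.trans_le hp) μ.toProb
      edist_comm := fun μ ν => wassersteinEDist_comm (zero_lt_one.trans_le hp) μ.toProb ν.toProb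
      edist_triangle := fun μ ν ρ => wassersteinEDist_triangle hp μ.toProb ν.toProb ρ.toProb
      eq_of_edist_eq_zero := fun h => toProb_injective
        (eq_of_wassersteinEDist_eq_zero (zero_lt_one.trans_le hp) h) }
  EMetricSpace.toMetricSpace fun μ ν =>
    (wassersteinEDist_lt_top hp μ.hasFiniteMoment ν.hasFiniteMoment).ne

end WassersteinSpace

end

theorem mainTheorem3 {X : Type*} [MetricSpace X] [CompleteSpace X] [MeasurableSpace X]
    [BorelSpace X] (p : ℝ) (hp : 1 ≤ p) :
    ∃ _ : MetricSpace (WassersteinSpace p X),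
      (∀ μ ν : WassersteinSpace p X, edist μ ν = wassersteinEDist p μ.toProb ν.toProb) ∧
      CompleteSpace (WassersteinSpace p X) ∧
      Dense {μ : WassersteinSpace p X | (μ.toProb : Measure X).support.Finite} := by
  let _ : MetricSpace (WassersteinSpace p X) := WassersteinSpace.metricSpace hp
  refine ⟨inferInstance, fun _ _ => rfl, ?_, fun μ => EMetric.mem_closure_iff.2 fun ε hε =>
    WassersteinSpace.exists_finite_support_wassersteinEDist_lt hp μ hε⟩
  have hsum : ∑' n : ℕ, (2⁻¹ : ℝ≥0∞) ^ n ≠ ∞ := by simp [ENNReal.tsum_geometric]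
  refine EMetric.complete_of_convergent_controlled_sequences (fun n => (2⁻¹ : ℝ≥0∞) ^ n)
    (fun n => ENNReal.pow_pos (by simp) n) fun μ hμ => ?_
  obtain ⟨ν, hν⟩ := WassersteinSpace.exists_wassersteinEDist_le_tsum hp μ
    (fun n => hμ n n (n + 1) le_rfl n.le_succ) hsum
  exact ⟨ν, tendsto_iff_edist_tendsto_0.2 (tendsto_of_tendsto_of_tendsto_of_le_of_le
    tendsto_const_nhds (ENNReal.tendsto_sum_nat_add _ hsum) (fun _ => zero_le) hν)⟩
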